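/- Let $\alpha,\beta,\gamma>0$ and let $F_{\alpha,\beta}^{(\gamma)}(z)=\sum_{k=0}^{\infty}\frac{z^k}{[\Gamma(\alpha k+\beta)]^{\gamma}}$ (this series converges). Let $[\Gamma(\alpha s+\beta)]^{\gamma}=\exp\bigl(\gamma\log\Gamma(\alpha s+\beta)\bigr)$ be the branch defined in the $s$-plane cut along $(-\infty,-\beta/\alpha]$ by the continuous logarithm of $\Gamma(\alpha s+\beta)$ that is real for $s>0$; thus $[\Gamma(\alpha x+\beta)]^{\gamma}>0$ for $x>0$. Let $z\in\mathbb{C}\setminus(-\infty,0]$, let $\theta$ be any value of $\operatorname{Arg}(-z)$, i.e. any real number with $-z=|z|e^{i\theta}$, and set $(-z)^s=\exp\{s[\log|z|+i\theta]\}$. Let $-\infty<\varphi_1<0<\varphi_2<+\infty$ and $0<c<1$, and let $\mathcal{L}_{+\infty}$ be a right loop: a piecewise continuously differentiable curve $L:\mathbb{R}\to\mathbb{C}$ (more generally, a continuous curve, differentiable off a countable set, whose derivative is locally integrable), situated in a horizontal strip, starting at $+\infty+i\varphi_1$ and terminating at $+\infty+i\varphi_2$ (that is, $\operatorname{Re}L(t)\to+\infty$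 as $t\to\pm\infty$, $\operatorname{Im}L(t)\to\varphi_1$ as $t\to-\infty$ and $\operatorname{Im}L(t)\to\varphi_2$ as $t\to+\infty$), and whose only point on the real line is $c$. Then the integral below exists, as the limit of the integrals over compact pieces $L([a,b])$ as $a\to-\infty$ and $b\to+\infty$ independently, and $$F_{\alpha,\beta}^{(\gamma)}(z)=\frac{1}{2\pi i}\int_{\mathcal{L}_{+\infty}}\frac{\Gamma(-s)\,\Gamma(1+s)}{[\Gamma(\alpha s+\beta)]^{\gamma}}\,(-z)^{s}\,ds+\frac{1}{[\Gamma(\beta)]^{\gamma}}.$$ -/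

import Mathlib

open Set Filter Topology MeasureTheory

namespace LeRoy

/-- The principal branch of `log Γ` on the plane cut along `(-∞, 0]`: the primitive of the digamma
function `Γ' / Γ` that vanishes at `1`, integrated along the segment from `1` to `w` (the cut plane
is star-shaped about `1`). The three theorems below say that it is continuous on the cut plane, is
a logarithm of `Γ` there, and is real on the positive half-line; this determines it. -/
noncomputable def logGamma (w : ℂ) : ℂ :=
  ∫ t in (0 : ℝ)..1, Complex.digamma (1 + (t : ℂ) * (w - 1)) * (w - 1)

theorem ne_neg_nat {w : ℂ} (hw : w ∈ Complex.slitPlane) (m : ℕ) : w ≠ -(m : ℂ) := by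
  rintro rfl
  rw [Complex.mem_slitPlane_iff] at hw
  simp at hw
  exact absurd hw (not_lt.mpr (Nat.cast_nonneg m))

theorem segment_mem {w : ℂ} (hw : w ∈ Complex.slitPlane) {t : ℝ} (ht : t ∈ Icc (0 : ℝ) 1) :
    1 + (t : ℂ) * (w - 1) ∈ Complex.slitPlane := by
  have h := Complex.starConvex_one_slitPlane.add_smul_sub_mem hw ht.1 ht.2
  simpa [Complex.real_smul] using h

theorem continuousOn_digamma : ContinuousOn Complex.digamma Complex.slitPlane := by
  have hd : DifferentiableOn ℂ Complex.Gamma Complex.slitPlane := fun w hw =>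
    (Complex.differentiableAt_Gamma w (ne_neg_nat hw)).differentiableWithinAt
  have h := (hd.deriv Complex.isOpen_slitPlane).continuousOn.div hd.continuousOn
    (fun w hw => Complex.Gamma_ne_zero (ne_neg_nat hw))
  exact h

theorem continuousOn_logGamma : ContinuousOn logGamma Complex.slitPlane := by
  rw [continuousOn_iff_continuous_domRestrict]
  have hc : Continuous (fun q : Complex.slitPlane × ℝ =>
      Complex.digamma (1 + ((projIcc (0 : ℝ) 1 zero_le_one q.2 : ℝ) : ℂ) * ((q.1 : ℂ) - 1))
        * ((q.1 : ℂ) - 1)) := by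
    refine Continuous.mul ?_ (by fun_prop)
    refine continuousOn_digamma.comp_continuous ?_
      (fun q => segment_mem q.1.2 (projIcc (0 : ℝ) 1 zero_le_one q.2).2)
    have : Continuous (fun q : Complex.slitPlane × ℝ =>
        ((projIcc (0 : ℝ) 1 zero_le_one q.2 : Icc (0 : ℝ) 1) : ℝ)) :=
      continuous_subtype_val.comp (continuous_projIcc.comp continuous_snd)
    fun_prop
  have h := intervalIntegral.continuous_parametric_intervalIntegral_of_continuous'
    (μ := volume) (f := fun (w : Complex.slitPlane) (t : ℝ) =>
      Complex.digamma (1 + ((projIcc (0 : ℝ) 1 zero_le_one t : ℝ) : ℂ) * ((w : ℂ) - 1))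
        * ((w : ℂ) - 1)) hc 0 1
  refine h.congr fun w => ?_
  refine intervalIntegral.integral_congr fun t ht => ?_
  rw [uIcc_of_le zero_le_one] at ht
  simp only [projIcc_of_mem zero_le_one ht]

theorem exp_logGamma {w : ℂ} (hw : w ∈ Complex.slitPlane) :
    Complex.exp (logGamma w) = Complex.Gamma w := by
  set p : ℝ → ℂ := fun t => 1 + (t : ℂ) * (w - 1) with hp
  set g : ℝ → ℂ := fun t => Complex.digamma (p t) * (w - 1) with hg
  have hpc : Continuous p := by fun_prop
  have hU : IsOpen (p ⁻¹' Complex.slitPlane) := Complex.isOpen_slitPlane.preimage hpc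
  have hgc : ContinuousOn g (p ⁻¹' Complex.slitPlane) :=
    (continuousOn_digamma.comp hpc.continuousOn (fun t ht => ht)).mul continuousOn_const
  have hsub : Icc (0 : ℝ) 1 ⊆ p ⁻¹' Complex.slitPlane := fun t ht => segment_mem hw ht
  have hder : ∀ t ∈ Icc (0 : ℝ) 1,
      HasDerivAt (fun t => Complex.Gamma (p t) * Complex.exp (-∫ u in (0 : ℝ)..t, g u)) 0 t := by
    intro t ht
    have hint : IntervalIntegrable g volume 0 t := by
      refine (hgc.mono (fun u hu => hsub ?_)).intervalIntegrable
      rw [uIcc_of_le ht.1] at hu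
      exact ⟨hu.1, hu.2.trans ht.2⟩
    have hI := intervalIntegral.integral_hasDerivAt_right hint
      (hgc.stronglyMeasurableAtFilter hU t (hsub ht)) (hgc.continuousAt (hU.mem_nhds (hsub ht)))
    have hpd : HasDerivAt p (w - 1) t := by
      have h1 : HasDerivAt (fun t : ℝ => (t : ℂ)) 1 t := Complex.ofRealCLM.hasDerivAt
      have h2 := (h1.mul_const (w - 1)).const_add 1
      rw [one_mul] at h2
      exact h2
    have hG := (Complex.differentiableAt_Gamma (p t) (ne_neg_nat (hsub ht))).hasDerivAt.comp t hpd
    have hne := Complex.Gamma_ne_zero (ne_neg_nat (hsub ht))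
    have hM := hG.mul hI.neg.cexp
    refine hM.congr_deriv ?_
    simp only [hg, Complex.digamma_def, logDeriv_apply, Function.comp]
    field_simp
    ring
  have hconst := constant_of_has_deriv_right_zero
    (fun t ht => (hder t ht).continuousAt.continuousWithinAt)
    (fun t ht => (hder t (Ico_subset_Icc_self ht)).hasDerivWithinAt) 1 (by simp)
  have h1 : p 1 = w := by simp [hp]
  have h0 : p 0 = 1 := by simp [hp]
  have hL : ∫ u in (0 : ℝ)..1, g u = logGamma w := rfl
  simp only [h1, h0, hL, intervalIntegral.integral_same, Complex.Gamma_one, neg_zero,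
    Complex.exp_zero, mul_one, Complex.exp_neg] at hconst
  field_simp at hconst
  exact hconst.symm

theorem logGamma_ofReal {x : ℝ} (hx : 0 < x) :
    logGamma (x : ℂ) = (Real.log (Real.Gamma x) : ℂ) := by
  have hpos : ∀ t ∈ uIcc (0 : ℝ) 1, 0 < 1 + t * (x - 1) := by
    intro t ht
    rw [uIcc_of_le zero_le_one] at ht
    rcases eq_or_lt_of_le ht.2 with h | h
    · subst h; linarith
    · nlinarith [mul_nonneg ht.1 hx.le]
  have hmem : ∀ t ∈ uIcc (0 : ℝ) 1, 1 + (t : ℂ) * ((x : ℂ) - 1) ∈ Complex.slitPlane := by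
    intro t ht
    have := Complex.ofReal_mem_slitPlane.mpr (hpos t ht)
    push_cast at this
    exact this
  have hder : ∀ t ∈ uIcc (0 : ℝ) 1,
      HasDerivAt (fun t : ℝ => ((Real.log (Real.Gamma (1 + t * (x - 1))) : ℝ) : ℂ))
        (Complex.digamma (1 + (t : ℂ) * ((x : ℂ) - 1)) * ((x : ℂ) - 1)) t := by
    intro t ht
    have hp := hpos t ht
    have hne : ∀ m : ℕ, 1 + t * (x - 1) ≠ -(m : ℝ) := fun m =>
      ((neg_nonpos.mpr m.cast_nonneg).trans_lt hp).ne'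
    have hR := (Real.differentiableAt_Gamma hne).hasDerivAt
    have hC : HasDerivAt Complex.Gamma _ ((1 + t * (x - 1) : ℝ) : ℂ) :=
      (Complex.differentiableAt_Gamma _
        (ne_neg_nat (Complex.ofReal_mem_slitPlane.mpr hp))).hasDerivAt
    have hRC := hR.ofReal_comp
    have hCR := hC.comp_ofReal
    simp only [Complex.Gamma_ofReal] at hCR
    have huniq := hRC.unique hCR
    have hlin : HasDerivAt (fun t : ℝ => 1 + t * (x - 1)) (x - 1) t := by
      simpa using ((hasDerivAt_id t).mul_const (x - 1)).const_add 1
    have hlog := (hR.log (Real.Gamma_pos_of_pos hp).ne').comp t hlin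
    refine hlog.ofReal_comp.congr_deriv ?_
    have e : 1 + (t : ℂ) * ((x : ℂ) - 1) = ((1 + t * (x - 1) : ℝ) : ℂ) := by push_cast; rfl
    rw [Complex.digamma_def, logDeriv_apply, e, ← huniq, Complex.Gamma_ofReal]
    push_cast
    ring
  have hcont : ContinuousOn (fun t : ℝ =>
      Complex.digamma (1 + (t : ℂ) * ((x : ℂ) - 1)) * ((x : ℂ) - 1)) (uIcc 0 1) :=
    (continuousOn_digamma.comp (by fun_prop) hmem).mul continuousOn_const
  have h := intervalIntegral.integral_eq_sub_of_hasDerivAt hder hcont.intervalIntegrable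
  rw [logGamma, h]
  simp

/-- The principal branch of `[Γ(αs + β)]^γ` in the `s`-plane cut along `(-∞, -β/α]`
(for `α, β > 0` this cut is exactly where `αs + β ∈ (-∞, 0]`); it is positive for `s > 0`. -/
noncomputable def gammaPow (α β γ : ℝ) (s : ℂ) : ℂ :=
  Complex.exp ((γ : ℂ) * logGamma ((α : ℂ) * s + (β : ℂ)))

theorem gammaPow_ofReal {α β : ℝ} (γ : ℝ) {x : ℝ} (h : 0 < α * x + β) :
    gammaPow α β γ (x : ℂ) = ((Real.Gamma (α * x + β) ^ γ : ℝ) : ℂ) := by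
  have e : (α : ℂ) * (x : ℂ) + (β : ℂ) = ((α * x + β : ℝ) : ℂ) := by push_cast; rfl
  rw [gammaPow, e, logGamma_ofReal h, Real.rpow_def_of_pos (Real.Gamma_pos_of_pos h)]
  push_cast
  rw [mul_comm]

/-- The Le Roy type function `F(z) = ∑ₖ z ^ k / Γ(αk + β) ^ γ`. -/
noncomputable def leRoy (α β γ : ℝ) (z : ℂ) : ℂ :=
  ∑' k : ℕ, z ^ k / ((Real.Gamma (α * k + β) ^ γ : ℝ) : ℂ)

/-- `(-z)^s = exp (s (log |z| + i θ))`, where `θ` is a value of `Arg (-z)`. -/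
noncomputable def negPow (z : ℂ) (θ : ℝ) (s : ℂ) : ℂ :=
  Complex.exp (s * ((Real.log ‖z‖ : ℂ) + Complex.I * (θ : ℂ)))

/-- The integrand `Γ(-s) Γ(1+s) (-z)^s / [Γ(αs + β)]^γ`. -/
noncomputable def integrand (α β γ : ℝ) (z : ℂ) (θ : ℝ) (s : ℂ) : ℂ :=
  Complex.Gamma (-s) * Complex.Gamma (1 + s) / gammaPow α β γ s * negPow z θ s

/-- `L : ℝ → ℂ` parametrizes a right loop: it is situated in a horizontal strip, starts at
`+∞ + i φ₁`, terminates at `+∞ + i φ₂`, and meets the real line only at the point `c`.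
The regularity asked for (continuous, differentiable off a countable set, with a locally integrable
derivative) holds for every piecewise `C¹` curve. -/
structure IsRightLoop (φ₁ φ₂ c : ℝ) (L : ℝ → ℂ) : Prop where
  continuous : Continuous L
  differentiable : ∃ S : Set ℝ, S.Countable ∧ ∀ t ∉ S, DifferentiableAt ℝ L t
  integrable_deriv : ∀ a b : ℝ, IntervalIntegrable (deriv L) volume a b
  strip : ∃ M : ℝ, ∀ t, |(L t).im| ≤ M
  re_start : Tendsto (fun t => (L t).re) atBot atTop
  im_start : Tendsto (fun t => (L t).im) atBot (𝓝 φ₁)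
  re_finish : Tendsto (fun t => (L t).re) atTop atTop
  im_finish : Tendsto (fun t => (L t).im) atTop (𝓝 φ₂)
  crossing : range L ∩ {s : ℂ | s.im = 0} = {(c : ℂ)}

/-- The integral of `f` along the curve `L : ℝ → ℂ` exists and equals `I`: the integrals over
compact pieces exist, and they converge to `I` as both ends of the piece tend to infinity
independently of each other. -/
def HasContourIntegral (f : ℂ → ℂ) (L : ℝ → ℂ) (I : ℂ) : Prop :=
  (∀ a b : ℝ, IntervalIntegrable (fun t => f (L t) * deriv L t) volume a b) ∧
  Tendsto (fun p : ℝ × ℝ => ∫ t in p.1..p.2, f (L t) * deriv L t) (atBot ×ˢ atTop) (𝓝 I)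

end LeRoy

/-!
By the reflection formula the integrand is `f(s) = -π g(s) / sin (π s)`, where
`g(s) = (-z)^s / [Γ(αs + β)]^γ` is holomorphic off the cut `(-∞, -β/α]`. At the pole `k ≥ 1` its
residue is `-(-1)^k g(k) = -z^k / Γ(αk + β)^γ`, and a right loop runs clockwise around all these
poles, so the integral is `2πi` times the sum of the series without its term `k = 0`.

A right loop need not have a tame parametrization near infinity, so the integral is handled through
primitives rather than through absolute convergence. Let `Gp` and `Gm` be primitives of `f` in the
upper and the lower half-plane that match across the interval `(0, 1)`
(`exists_matching_primitives`). Glued together (`HasJump.exists_glued`) they give a primitive `G` on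
the plane cut along `(-∞, 0]` and `[1, ∞)`, which contains the loop, and the integral over a compact
piece of the loop is a difference of values of `G`. Because `|Γ|` grows superexponentially in
horizontal half-strips (`exists_exp_mul_re_le_norm_Gamma`), `f` decays exponentially there away from
the real axis, so `G` has limits `l₂`, `l₁` at `+∞ + iφ₂`, `+∞ + iφ₁`
(`exists_tendsto_of_norm_deriv_le`), and the integral along the loop is `l₂ - l₁`.

To find `l₂ - l₁`, one follows the mismatch of `Gp` and `Gm` across the intervals `(n, n + 1)`.
Passing a simple pole of residue `r` changes it by `-2πir` (`HasJump.succ`), so across `(n, n + 1)`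
it is `2πi` times the `n`-th partial sum of the series without its term `k = 0`
(`hasJump_integrand`). On the other hand it equals
`Gp(n + 1/2 + iφ₂) - Gm(n + 1/2 + iφ₁)` up to the integral of `f` over a vertical segment
(`HasJump.norm_sub_le`), which tends to zero because `|sin (π s)| ≥ 1` for `Re s = n + 1/2`.
-/

namespace LeRoy

/-! ### Growth of the Gamma function and holomorphy of its logarithm -/

/-- In a horizontal half-strip `|Γ|` grows faster than any exponential. Only the functional equation
and the absence of zeros are used, so Stirling's formula is not needed. -/
theorem exists_exp_mul_re_le_norm_Gamma {r : ℝ} (hr : 0 < r) (A M : ℝ) :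
    ∃ C > 0, ∀ w : ℂ, r ≤ w.re → |w.im| ≤ M → C * Real.exp (A * w.re) ≤ ‖Complex.Gamma w‖ := by
  set R : ℝ := max r (Real.exp A)
  have hrR : r ≤ R := le_max_left _ _
  have hne : ∀ w : ℂ, 0 < w.re → ∀ m : ℕ, w ≠ -(m : ℂ) := fun w hw =>
    ne_neg_nat (Complex.mem_slitPlane_iff.mpr (Or.inl hw))
  -- On a compact rectangle of width at least one the bound holds by continuity.
  have hK : IsCompact (Icc r (R + 1) ×ℂ Icc (-M) M) := isCompact_Icc.reProdIm isCompact_Icc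
  have hcont : ContinuousOn (fun w : ℂ => ‖Complex.Gamma w‖ / Real.exp (A * w.re))
      (Icc r (R + 1) ×ℂ Icc (-M) M) := by
    refine ContinuousOn.div ?_ (by fun_prop) (fun w _ => (Real.exp_pos _).ne')
    intro w hw
    exact ((Complex.differentiableAt_Gamma w
      (hne w (hr.trans_le hw.1.1))).continuousAt.norm).continuousWithinAt
  obtain ⟨C, hC, hCK⟩ : ∃ C > 0, ∀ w ∈ Icc r (R + 1) ×ℂ Icc (-M) M,
      C ≤ ‖Complex.Gamma w‖ / Real.exp (A * w.re) :=
    hK.exists_forall_le' hcont (a := 0) fun w hw =>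
      div_pos (norm_pos_iff.mpr (Complex.Gamma_ne_zero (hne w (hr.trans_le hw.1.1))))
        (Real.exp_pos _)
  -- One step of `Γ (w + 1) = w Γ w` gains the factor `‖w‖ ≥ exp A` once `Re w ≥ R`.
  have key : ∀ n : ℕ, ∀ w : ℂ, r ≤ w.re → w.re ≤ R + 1 + n → |w.im| ≤ M →
      C * Real.exp (A * w.re) ≤ ‖Complex.Gamma w‖ := by
    intro n
    induction n with
    | zero =>
      intro w h1 h2 h3
      have := hCK w ⟨⟨h1, by simpa using h2⟩, abs_le.mp h3⟩
      rwa [le_div_iff₀ (Real.exp_pos _)] at this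
    | succ n ih =>
      intro w h1 h2 h3
      by_cases h4 : w.re ≤ R + 1
      · exact ih w h1 (h4.trans (by linarith [n.cast_nonneg (α := ℝ)])) h3
      push Not at h4
      have hre : (w - 1).re = w.re - 1 := by simp
      have h5 := ih (w - 1) (by rw [hre]; linarith) (by rw [hre]; push_cast at h2; linarith)
        (by simpa using h3)
      have hw0 : w - 1 ≠ 0 := fun h => by
        have := congrArg Complex.re h
        rw [hre, Complex.zero_re] at this
        linarith
      have h6 := Complex.Gamma_add_one (w - 1) hw0
      rw [sub_add_cancel] at h6
      have h7 : Real.exp A ≤ ‖w - 1‖ :=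
        calc Real.exp A ≤ R := le_max_right _ _
          _ ≤ (w - 1).re := by rw [hre]; linarith
          _ ≤ ‖w - 1‖ := Complex.re_le_norm _
      rw [h6, norm_mul]
      calc C * Real.exp (A * w.re) = Real.exp A * (C * Real.exp (A * (w - 1).re)) := by
            rw [hre, mul_left_comm, ← Real.exp_add]; ring_nf
        _ ≤ ‖w - 1‖ * ‖Complex.Gamma (w - 1)‖ := by gcongr
  refine ⟨C, hC, fun w h1 h2 => ?_⟩
  obtain ⟨n, hn⟩ := exists_nat_ge (w.re - (R + 1))
  exact key n w h1 (by linarith) h2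

/-- A continuous logarithm of a nonvanishing holomorphic function is holomorphic. -/
theorem differentiableAt_logGamma {w : ℂ} (hw : w ∈ Complex.slitPlane) :
    DifferentiableAt ℂ logGamma w := by
  have hopen := Complex.isOpen_slitPlane.mem_nhds hw
  have hcont : ContinuousAt logGamma w := continuousOn_logGamma.continuousAt hopen
  have hne : Complex.Gamma w ≠ 0 := Complex.Gamma_ne_zero (ne_neg_nat hw)
  -- Near `w`, `logGamma` differs from its value at `w` by less than `π`.
  have hev : logGamma =ᶠ[𝓝 w]
      fun v => Complex.log (Complex.Gamma v / Complex.Gamma w) + logGamma w := by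
    filter_upwards [hopen, hcont.eventually (Metric.ball_mem_nhds _ Real.pi_pos)] with v hv hd
    have hd' : |(logGamma v - logGamma w).im| < Real.pi :=
      (Complex.abs_im_le_norm _).trans_lt (by simpa [dist_eq_norm] using hd)
    rw [abs_lt] at hd'
    rw [← exp_logGamma hv, ← exp_logGamma hw, ← Complex.exp_sub,
      Complex.log_exp hd'.1 hd'.2.le, sub_add_cancel]
  refine DifferentiableAt.congr_of_eventuallyEq ?_ hev
  refine DifferentiableAt.add_const _ (DifferentiableAt.clog ?_ ?_)
  · exact (Complex.differentiableAt_Gamma w (ne_neg_nat hw)).div_const _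
  · simp [div_self hne]

/-- The modulus of `[Γ(αs + β)]^γ` does not depend on the branch of the logarithm, which is why
lower bounds for `|Γ|` suffice to bound the integrand. -/
theorem norm_gammaPow (α β γ : ℝ) {s : ℂ} (hs : (α : ℂ) * s + β ∈ Complex.slitPlane) :
    ‖gammaPow α β γ s‖ = ‖Complex.Gamma ((α : ℂ) * s + β)‖ ^ γ := by
  have h := exp_logGamma hs
  rw [← h, Complex.norm_exp, gammaPow, Complex.norm_exp, ← Real.exp_mul, Complex.re_ofReal_mul,
    mul_comm]

/-! ### The nonperiodic factor of the integrand -/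

/-- The integrand without its periodic factor `Γ(-s) Γ(1+s) = -π / sin (π s)`. -/
noncomputable def integrandReg (α β γ : ℝ) (z : ℂ) (θ : ℝ) (s : ℂ) : ℂ :=
  negPow z θ s / gammaPow α β γ s

theorem integrand_eq (α β γ : ℝ) (z : ℂ) (θ : ℝ) (s : ℂ) :
    integrand α β γ z θ s =
      -(Real.pi : ℂ) * integrandReg α β γ z θ s / Complex.sin (Real.pi * s) := by
  have h := Complex.Gamma_mul_Gamma_one_sub (-s)
  rw [sub_neg_eq_add, mul_neg, Complex.sin_neg] at h
  rw [integrand, integrandReg, h, div_neg]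
  ring

theorem differentiableAt_integrandReg (α β γ : ℝ) (z : ℂ) (θ : ℝ) {s : ℂ}
    (hs : (α : ℂ) * s + β ∈ Complex.slitPlane) :
    DifferentiableAt ℂ (integrandReg α β γ z θ) s := by
  have h1 : DifferentiableAt ℂ (fun s : ℂ => logGamma ((α : ℂ) * s + β)) s :=
    (differentiableAt_logGamma hs).fun_comp' s (by fun_prop)
  have h2 : DifferentiableAt ℂ (gammaPow α β γ) s := (h1.const_mul _).cexp
  have h3 : DifferentiableAt ℂ (negPow z θ) s := by unfold negPow; fun_prop
  exact h3.div h2 (Complex.exp_ne_zero _)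

theorem mem_slitPlane_of_re_nonneg {α β : ℝ} (hα : 0 < α) (hβ : 0 < β) {s : ℂ} (hs : 0 ≤ s.re) :
    (α : ℂ) * s + β ∈ Complex.slitPlane := by
  refine Complex.mem_slitPlane_iff.mpr (Or.inl ?_)
  simp only [Complex.add_re, Complex.re_ofReal_mul, Complex.ofReal_re]
  positivity

theorem mem_slitPlane_of_im_ne_zero {α : ℝ} (β : ℝ) (hα : 0 < α) {s : ℂ} (hs : s.im ≠ 0) :
    (α : ℂ) * s + β ∈ Complex.slitPlane := by
  refine Complex.mem_slitPlane_iff.mpr (Or.inr ?_)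
  simp [hα.ne', hs]

/-- The decay rate `exp (-x)` is one convenient choice: by
`exists_exp_mul_re_le_norm_Gamma` any exponential rate is possible. -/
theorem exists_norm_integrandReg_le {α β γ : ℝ} (hα : 0 < α) (hβ : 0 < β) (hγ : 0 < γ) (z : ℂ)
    (θ M : ℝ) :
    ∃ K, 0 ≤ K ∧ ∀ s : ℂ, 0 ≤ s.re → |s.im| ≤ M →
      ‖integrandReg α β γ z θ s‖ ≤ K * Real.exp (-s.re) := by
  -- `A` is chosen so that the growth of `Γ ^ γ` beats `|z| ^ x` by the factor `exp x`.
  set A : ℝ := (Real.log ‖z‖ + 1) / (α * γ) with hA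
  obtain ⟨C, hC, hbound⟩ := exists_exp_mul_re_le_norm_Gamma hβ A (α * M)
  refine ⟨Real.exp (|θ| * M) / (C * Real.exp (A * β)) ^ γ, by positivity, fun s h1 h2 => ?_⟩
  have hre : ((α : ℂ) * s + β).re = α * s.re + β := by simp
  have him : ((α : ℂ) * s + β).im = α * s.im := by simp
  have hG := hbound ((α : ℂ) * s + β) (by rw [hre]; nlinarith)
    (by rw [him, abs_mul, abs_of_pos hα]; gcongr)
  rw [hre] at hG
  have hneg : ‖negPow z θ s‖ ≤ Real.exp (Real.log ‖z‖ * s.re) * Real.exp (|θ| * M) := by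
    rw [negPow, Complex.norm_exp, ← Real.exp_add]
    apply Real.exp_le_exp.mpr
    have h3 : -(s.im * θ) ≤ |θ| * M := by
      rw [mul_comm |θ| M]
      exact (neg_le_abs _).trans (by rw [abs_mul]; gcongr)
    simp only [Complex.mul_re, Complex.add_re, Complex.add_im, Complex.ofReal_re,
      Complex.ofReal_im, Complex.I_re, Complex.I_im, Complex.mul_im]
    linarith
  have hden : (C * Real.exp (A * β)) ^ γ * Real.exp ((Real.log ‖z‖ + 1) * s.re)
      ≤ ‖gammaPow α β γ s‖ := by
    rw [norm_gammaPow α β γ (mem_slitPlane_of_re_nonneg hα hβ h1)]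
    refine le_trans (le_of_eq ?_) (Real.rpow_le_rpow (by positivity) hG hγ.le)
    have e : A * (α * s.re + β) = A * β + A * α * s.re := by ring
    rw [e, Real.exp_add, ← mul_assoc,
      Real.mul_rpow (x := C * Real.exp (A * β)) (by positivity) (by positivity),
      ← Real.exp_mul (A * α * s.re)]
    congr 2
    rw [hA]
    field_simp
  rw [integrandReg, norm_div]
  calc ‖negPow z θ s‖ / ‖gammaPow α β γ s‖
      ≤ (Real.exp (Real.log ‖z‖ * s.re) * Real.exp (|θ| * M)) /
        ((C * Real.exp (A * β)) ^ γ * Real.exp ((Real.log ‖z‖ + 1) * s.re)) := by gcongr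
    _ = _ := by
      rw [add_mul, one_mul, Real.exp_add, Real.exp_neg]
      field_simp

theorem integrandReg_natCast {α β : ℝ} (hα : 0 < α) (hβ : 0 < β) (γ : ℝ) {z : ℂ} {θ : ℝ}
    (hz : z ≠ 0) (hθ : (‖z‖ : ℂ) * Complex.exp (Complex.I * (θ : ℂ)) = -z) (k : ℕ) :
    integrandReg α β γ z θ k = (-z) ^ k / ((Real.Gamma (α * k + β) ^ γ : ℝ) : ℂ) := by
  have h1 := gammaPow_ofReal (α := α) (β := β) γ (x := k) (by positivity)
  rw [Complex.ofReal_natCast] at h1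
  rw [integrandReg, h1, negPow, Complex.exp_nat_mul, Complex.exp_add, ← Complex.ofReal_exp,
    Real.exp_log (norm_pos_iff.mpr hz), hθ]

theorem summable_leRoy {α β γ : ℝ} (hα : 0 < α) (hβ : 0 < β) (hγ : 0 < γ) {z : ℂ} {θ : ℝ}
    (hz : z ≠ 0) (hθ : (‖z‖ : ℂ) * Complex.exp (Complex.I * (θ : ℂ)) = -z) :
    Summable (fun k : ℕ => z ^ k / ((Real.Gamma (α * k + β) ^ γ : ℝ) : ℂ)) := by
  obtain ⟨K, -, hK⟩ := exists_norm_integrandReg_le hα hβ hγ z θ 0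
  refine Summable.of_norm_bounded (g := fun k : ℕ => K * Real.exp (-k))
    (Real.summable_exp_neg_nat.mul_left K) fun k => ?_
  have h := hK k (by simp) (by simp)
  rw [integrandReg_natCast hα hβ γ hz hθ k] at h
  simpa using h

/-! ### Primitives in the half-planes and their jump across the real axis -/

theorem exists_primitive {S : Set ℂ} {f : ℂ → ℂ} (hS : Convex ℝ S) (hSo : IsOpen S)
    (hf : ∀ s ∈ S, DifferentiableAt ℂ f s) : ∃ F : ℂ → ℂ, ∀ s ∈ S, HasDerivAt F (f s) s := by
  obtain ⟨F, hF⟩ := hS.exists_forall_hasDerivWithinAt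
    (fun s hs => (hf s hs).differentiableWithinAt)
  exact ⟨F, fun s hs => (hF s hs).hasDerivAt (hSo.mem_nhds hs)⟩

theorem exists_eq_add_const {S : Set ℂ} {f F G : ℂ → ℂ} (hS : Convex ℝ S)
    (hF : ∀ s ∈ S, HasDerivAt F (f s) s) (hG : ∀ s ∈ S, HasDerivAt G (f s) s) :
    ∃ c : ℂ, ∀ s ∈ S, F s = G s + c := by
  rcases S.eq_empty_or_nonempty with rfl | ⟨a, ha⟩
  · simp
  refine ⟨F a - G a, fun s hs => ?_⟩
  have h := hS.norm_image_sub_le_of_norm_hasDerivWithin_le (f := fun s => F s - G s)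
    (f' := fun _ => 0) (C := 0)
    (fun x hx => (((hF x hx).sub (hG x hx)).congr_deriv (sub_self _)).hasDerivWithinAt)
    (fun x _ => by simp) ha hs
  rw [zero_mul, norm_le_zero_iff] at h
  linear_combination h

/-- The open vertical strip `a < Re s < b`. -/
def vStrip (a b : ℝ) : Set ℂ := {s : ℂ | a < s.re ∧ s.re < b}

theorem convex_vStrip (a b : ℝ) : Convex ℝ (vStrip a b) :=
  (convex_halfSpace_re_gt a).inter (convex_halfSpace_re_lt b)

theorem isOpen_vStrip (a b : ℝ) : IsOpen (vStrip a b) :=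
  (isOpen_lt continuous_const Complex.continuous_re).inter
    (isOpen_lt Complex.continuous_re continuous_const)

theorem convex_im_pos : Convex ℝ {s : ℂ | 0 < s.im} := convex_halfSpace_im_gt 0

theorem convex_im_neg : Convex ℝ {s : ℂ | s.im < 0} := convex_halfSpace_im_lt 0

theorem isOpen_im_pos : IsOpen {s : ℂ | 0 < s.im} :=
  isOpen_lt continuous_const Complex.continuous_im

theorem isOpen_im_neg : IsOpen {s : ℂ | s.im < 0} :=
  isOpen_lt Complex.continuous_im continuous_const

/-- On the strip `k < Re s < k + 1` there is a primitive of `f` equal to `Gm` in the lower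
half-plane and to `Gp - C` in the upper one. So `C` is the amount by which the primitives `Gp`, `Gm`
in the two half-planes fail to match across the interval `(k, k + 1)`. -/
def HasJump (f Gp Gm : ℂ → ℂ) (k : ℕ) (C : ℂ) : Prop :=
  ∃ Q : ℂ → ℂ, ∀ s ∈ vStrip k (k + 1), HasDerivAt Q (f s) s ∧
    (0 < s.im → Gp s = Q s + C) ∧ (s.im < 0 → Gm s = Q s)

theorem log_neg_of_im_pos {w : ℂ} (hw : 0 < w.im) :
    Complex.log (-w) = Complex.log w - Real.pi * Complex.I := by
  rw [Complex.log, Complex.log, norm_neg, Complex.arg_neg_eq_arg_sub_pi_of_im_pos hw]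
  push_cast
  ring

theorem log_neg_of_im_neg {w : ℂ} (hw : w.im < 0) :
    Complex.log (-w) = Complex.log w + Real.pi * Complex.I := by
  rw [Complex.log, Complex.log, norm_neg, Complex.arg_neg_eq_arg_add_pi_of_im_neg hw]
  push_cast
  ring

theorem hasDerivAt_log_sub {a s : ℂ} (hs : s - a ∈ Complex.slitPlane) :
    HasDerivAt (fun s => Complex.log (s - a)) (1 / (s - a)) s :=
  ((hasDerivAt_id s).sub_const a).clog hs

theorem hasDerivAt_log_sub' {a s : ℂ} (hs : a - s ∈ Complex.slitPlane) :
    HasDerivAt (fun s => Complex.log (a - s)) (1 / (s - a)) s := by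
  have h := ((hasDerivAt_id s).const_sub a).clog hs
  refine h.congr_deriv ?_
  rw [id_eq, ← neg_sub s a, div_neg, neg_div, neg_neg]

/-- Passing a simple pole of residue `r` changes the jump by `-2πir`: left of the pole a primitive
of `r / (s - k)` that is continuous across the real axis is `r log (k - s)`, right of it
`r log (s - k)`, and the former is the latter minus `πir` in the upper half-plane and plus `πir` in
the lower one. In the statement the pole is `k + 1`. -/
theorem HasJump.succ {f h Gp Gm : ℂ → ℂ} {k : ℕ} {C r : ℂ}
    (hGp : ∀ s : ℂ, 0 < s.im → HasDerivAt Gp (f s) s)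
    (hGm : ∀ s : ℂ, s.im < 0 → HasDerivAt Gm (f s) s)
    (hh : ∀ s ∈ vStrip k (k + 2), DifferentiableAt ℂ h s)
    (hf : ∀ s ∈ vStrip k (k + 2), s ≠ (k + 1 : ℂ) → f s = r * (1 / (s - (k + 1))) + h s)
    (hJ : HasJump f Gp Gm k C) :
    HasJump f Gp Gm (k + 1) (C - 2 * Real.pi * Complex.I * r) := by
  obtain ⟨Q, hQ⟩ := hJ
  obtain ⟨P, hP⟩ := exists_primitive (convex_vStrip k (k + 2)) (isOpen_vStrip _ _) hh
  have hne : ∀ s : ℂ, s - (k + 1) ∈ Complex.slitPlane → s ≠ (k + 1 : ℂ) := by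
    rintro s hs rfl
    simp at hs
  have hne' : ∀ s : ℂ, (k + 1) - s ∈ Complex.slitPlane → s ≠ (k + 1 : ℂ) := by
    rintro s hs rfl
    simp at hs
  have hR : ∀ s ∈ vStrip k (k + 2), s - (k + 1) ∈ Complex.slitPlane →
      HasDerivAt (fun s => r * Complex.log (s - (k + 1)) + P s) (f s) s := fun s hs hs' => by
    rw [hf s hs (hne s hs')]
    exact ((hasDerivAt_log_sub hs').const_mul r).add (hP s hs)
  have hL : ∀ s ∈ vStrip k (k + 2), (k + 1) - s ∈ Complex.slitPlane →
      HasDerivAt (fun s => r * Complex.log ((k + 1) - s) + P s) (f s) s := fun s hs hs' => by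
    rw [hf s hs (hne' s hs')]
    exact ((hasDerivAt_log_sub' hs').const_mul r).add (hP s hs)
  have him : ∀ s : ℂ, (s - (k + 1)).im = s.im := fun s => by simp
  obtain ⟨a, ha⟩ := exists_eq_add_const ((convex_vStrip k (k + 2)).inter convex_im_pos)
    (fun s hs => hGp s hs.2) (fun s hs => hR s hs.1
      (Complex.mem_slitPlane_iff.mpr (Or.inr (by rw [him]; exact hs.2.ne'))))
  obtain ⟨b, hb⟩ := exists_eq_add_const ((convex_vStrip k (k + 2)).inter convex_im_neg)
    (fun s hs => hGm s hs.2) (fun s hs => hR s hs.1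
      (Complex.mem_slitPlane_iff.mpr (Or.inr (by rw [him]; exact (show s.im < 0 from hs.2).ne))))
  have hsub : vStrip k (k + 1) ⊆ vStrip k (k + 2) := fun s hs => ⟨hs.1, by linarith [hs.2]⟩
  obtain ⟨e, he⟩ := exists_eq_add_const (convex_vStrip k (k + 1)) (fun s hs => (hQ s hs).1)
    (fun s hs => hL s (hsub hs)
      (Complex.mem_slitPlane_iff.mpr (Or.inl (by simpa using hs.2))))
  -- The constants are compared at one point on each side of the real axis, left of the pole.
  have hmem : ∀ y : ℝ, (⟨k + 1 / 2, y⟩ : ℂ) ∈ vStrip k (k + 1) := fun y => by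
    constructor <;> dsimp <;> linarith
  have hab : a - b = C - 2 * Real.pi * Complex.I * r := by
    have h1 := (hQ _ (hmem 1)).2.1 one_pos
    have h2 := (hQ _ (hmem (-1))).2.2 (by simp)
    rw [he _ (hmem 1), ha _ ⟨hsub (hmem 1), show (0 : ℝ) < 1 from one_pos⟩,
      ← neg_sub _ ((k : ℂ) + 1), log_neg_of_im_pos (by rw [him]; exact one_pos)] at h1
    rw [he _ (hmem (-1)), hb _ ⟨hsub (hmem (-1)), by simp⟩,
      ← neg_sub _ ((k : ℂ) + 1), log_neg_of_im_neg (by rw [him]; simp)] at h2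
    linear_combination h1 - h2
  have hsub' : vStrip (k + 1 : ℕ) ((k + 1 : ℕ) + 1) ⊆ vStrip k (k + 2) := fun s hs => by
    have h1 := hs.1
    have h2 := hs.2
    push_cast at h1 h2
    exact ⟨by linarith, by linarith⟩
  refine ⟨fun s => r * Complex.log (s - (k + 1)) + P s + b, fun s hs => ⟨?_, fun hi => ?_,
    fun hi => ?_⟩⟩
  · refine (hR s (hsub' hs) (Complex.mem_slitPlane_iff.mpr (Or.inl ?_))).add_const b
    have h1 := hs.1
    push_cast at h1
    simpa using h1
  · rw [ha s ⟨hsub' hs, hi⟩]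
    linear_combination hab
  · exact hb s ⟨hsub' hs, hi⟩

/-- The primitives in the half-planes are normalized by a common primitive on `0 < Re s < 1`, the
strip in which a right loop crosses the real axis. -/
theorem exists_matching_primitives {f : ℂ → ℂ} (hp : ∀ s : ℂ, 0 < s.im → DifferentiableAt ℂ f s)
    (hm : ∀ s : ℂ, s.im < 0 → DifferentiableAt ℂ f s)
    (h0 : ∀ s ∈ vStrip 0 1, DifferentiableAt ℂ f s) :
    ∃ Gp Gm : ℂ → ℂ, (∀ s : ℂ, 0 < s.im → HasDerivAt Gp (f s) s) ∧
      (∀ s : ℂ, s.im < 0 → HasDerivAt Gm (f s) s) ∧ HasJump f Gp Gm 0 0 := by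
  obtain ⟨Gp, hGp⟩ := exists_primitive convex_im_pos isOpen_im_pos hp
  obtain ⟨Gm, hGm⟩ := exists_primitive convex_im_neg isOpen_im_neg hm
  obtain ⟨Q, hQ⟩ := exists_primitive (convex_vStrip 0 1) (isOpen_vStrip 0 1) h0
  obtain ⟨a, ha⟩ := exists_eq_add_const ((convex_vStrip 0 1).inter convex_im_pos)
    (fun s hs => hQ s hs.1) (fun s hs => hGp s hs.2)
  obtain ⟨b, hb⟩ := exists_eq_add_const ((convex_vStrip 0 1).inter convex_im_neg)
    (fun s hs => hQ s hs.1) (fun s hs => hGm s hs.2)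
  refine ⟨fun s => Gp s + a, fun s => Gm s + b, fun s hs => (hGp s hs).add_const a,
    fun s hs => (hGm s hs).add_const b, Q, fun s hs => ?_⟩
  have hs' : s ∈ vStrip 0 1 := by simpa using hs
  exact ⟨hQ s hs', fun hi => by rw [ha s ⟨hs', hi⟩, add_zero], fun hi => (hb s ⟨hs', hi⟩).symm⟩

/-- A pair of half-plane primitives without jump over `(0, 1)` glues to a primitive on the plane cut
along `(-∞, 0]` and `[1, ∞)`. -/
theorem HasJump.exists_glued {f Gp Gm : ℂ → ℂ}
    (hGp : ∀ s : ℂ, 0 < s.im → HasDerivAt Gp (f s) s)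
    (hGm : ∀ s : ℂ, s.im < 0 → HasDerivAt Gm (f s) s) (hJ : HasJump f Gp Gm 0 0) :
    ∃ G : ℂ → ℂ, (∀ s : ℂ, s.im ≠ 0 ∨ s ∈ vStrip 0 1 → HasDerivAt G (f s) s) ∧
      (∀ s : ℂ, 0 < s.im → G s = Gp s) ∧ (∀ s : ℂ, s.im < 0 → G s = Gm s) := by
  classical
  obtain ⟨Q, hQ⟩ := hJ
  simp only [Nat.cast_zero, zero_add, add_zero] at hQ
  set G : ℂ → ℂ := fun s => if 0 < s.im then Gp s else if s.im < 0 then Gm s else Q s with hG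
  have hpos : ∀ s : ℂ, 0 < s.im → G s = Gp s := fun s hs => by simp [hG, hs]
  have hneg : ∀ s : ℂ, s.im < 0 → G s = Gm s := fun s hs => by simp [hG, hs, hs.le]
  have hmid : ∀ s ∈ vStrip 0 1, G s = Q s := fun s hs => by
    rcases lt_trichotomy s.im 0 with h | h | h
    · rw [hneg s h, (hQ s hs).2.2 h]
    · simp [hG, h]
    · rw [hpos s h, (hQ s hs).2.1 h]
  refine ⟨G, fun s hs => ?_, hpos, hneg⟩
  rcases hs with hs | hs
  · rcases lt_or_gt_of_ne hs with h | h
    · exact (hGm s h).congr_of_eventuallyEq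
        (eventually_of_mem (isOpen_im_neg.mem_nhds h) hneg)
    · exact (hGp s h).congr_of_eventuallyEq
        (eventually_of_mem (isOpen_im_pos.mem_nhds h) hpos)
  · exact (hQ s hs).1.congr_of_eventuallyEq
      (eventually_of_mem ((isOpen_vStrip 0 1).mem_nhds hs) hmid)

/-! ### Limits at infinity and the integral along a right loop -/

/-- A function whose derivative decays exponentially in a horizontal half-strip has a limit at
infinity there. -/
theorem exists_tendsto_of_norm_deriv_le {f G : ℂ → ℂ} {y₁ y₂ K : ℝ}
    (hy : y₁ ≤ y₂) (hG : ∀ s : ℂ, 0 ≤ s.re → s.im ∈ Icc y₁ y₂ → HasDerivAt G (f s) s)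
    (hK : 0 ≤ K) (hf : ∀ s : ℂ, 0 ≤ s.re → s.im ∈ Icc y₁ y₂ → ‖f s‖ ≤ K * Real.exp (-s.re)) :
    ∃ l : ℂ, ∀ {ι : Type} (F : Filter ι) (u : ι → ℂ), Tendsto (fun i => (u i).re) F atTop →
      (∀ᶠ i in F, (u i).im ∈ Icc y₁ y₂) → Tendsto (fun i => G (u i)) F (𝓝 l) := by
  have hmvt : ∀ n : ℕ, ∀ s w : ℂ, n ≤ s.re → s.im ∈ Icc y₁ y₂ → n ≤ w.re → w.im ∈ Icc y₁ y₂ →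
      ‖G w - G s‖ ≤ K * Real.exp (-1) ^ n * ‖w - s‖ := by
    intro n s w hs hs' hw hw'
    have hc : Convex ℝ ({s : ℂ | (n : ℝ) ≤ s.re} ∩ ({s : ℂ | y₁ ≤ s.im} ∩ {s : ℂ | s.im ≤ y₂})) :=
      (convex_halfSpace_re_ge _).inter ((convex_halfSpace_im_ge _).inter (convex_halfSpace_im_le _))
    refine hc.norm_image_sub_le_of_norm_hasDerivWithin_le (f' := f)
      (fun x hx => (hG x (n.cast_nonneg.trans hx.1) hx.2).hasDerivWithinAt) (fun x hx => ?_)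
      ⟨hs, hs'⟩ ⟨hw, hw'⟩
    refine (hf x (n.cast_nonneg.trans hx.1) hx.2).trans ?_
    rw [← Real.exp_nat_mul]
    have : (n : ℝ) ≤ x.re := hx.1
    gcongr
    linarith
  have he1 : Real.exp (-1) < 1 := by simp
  -- Along the integer abscissas the increments are dominated by a geometric series; every other
  -- point of the half-strip lies at bounded distance from one of these.
  set v : ℕ → ℂ := fun n => ⟨n, y₁⟩ with hv
  have hcau : CauchySeq (fun n => G (v n)) := by
    refine cauchySeq_of_le_geometric (Real.exp (-1)) K he1 fun n => ?_
    have h := hmvt n (v (n + 1)) (v n) (by simp [hv]) (left_mem_Icc.mpr hy) (by simp [hv])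
      (left_mem_Icc.mpr hy)
    have e : v n - v (n + 1) = -1 := by apply Complex.ext <;> simp [hv]
    rw [e, norm_neg, norm_one, mul_one] at h
    rwa [dist_eq_norm]
  obtain ⟨l, hl⟩ := cauchySeq_tendsto_of_complete hcau
  refine ⟨l, fun F u hre him => ?_⟩
  have hfloor : Tendsto (fun i => ⌊(u i).re⌋₊) F atTop := tendsto_nat_floor_atTop.comp hre
  have h1 : Tendsto (fun i => G (v ⌊(u i).re⌋₊)) F (𝓝 l) := hl.comp hfloor
  have h2 : Tendsto (fun i => G (u i) - G (v ⌊(u i).re⌋₊)) F (𝓝 0) := by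
    have h3 : Tendsto (fun i => K * Real.exp (-1) ^ ⌊(u i).re⌋₊ * (1 + (y₂ - y₁))) F (𝓝 0) := by
      have := (tendsto_pow_atTop_nhds_zero_of_lt_one (Real.exp_pos _).le he1).comp hfloor
      simpa using (this.const_mul K).mul_const (1 + (y₂ - y₁))
    refine squeeze_zero_norm' ?_ h3
    filter_upwards [him, hre.eventually_ge_atTop 0] with i hi hi0
    refine (hmvt _ (v ⌊(u i).re⌋₊) (u i) le_rfl (left_mem_Icc.mpr hy)
      (Nat.floor_le hi0) hi).trans ?_
    gcongr
    refine (Complex.norm_le_abs_re_add_abs_im _).trans ?_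
    have hlt := Nat.lt_floor_add_one (u i).re
    have hle := Nat.floor_le hi0
    have e1 : (u i - v ⌊(u i).re⌋₊).re = (u i).re - ⌊(u i).re⌋₊ := rfl
    have e2 : (u i - v ⌊(u i).re⌋₊).im = (u i).im - y₁ := rfl
    rw [e1, e2, abs_of_nonneg (by linarith), abs_of_nonneg (by linarith [hi.1])]
    linarith [hi.2]
  simpa using h2.add h1

/-- Newton-Leibniz along a right loop, for a function with a primitive off the cuts. -/
theorem IsRightLoop.hasContourIntegral {φ₁ φ₂ c : ℝ} {L : ℝ → ℂ} (hL : IsRightLoop φ₁ φ₂ c L)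
    (hc₀ : 0 < c) (hc₁ : c < 1) {f G : ℂ → ℂ}
    (hf : ∀ s : ℂ, s.im ≠ 0 ∨ s ∈ vStrip 0 1 → ContinuousAt f s)
    (hG : ∀ s : ℂ, s.im ≠ 0 ∨ s ∈ vStrip 0 1 → HasDerivAt G (f s) s) {l₁ l₂ : ℂ}
    (h₁ : Tendsto (fun t => G (L t)) atBot (𝓝 l₁)) (h₂ : Tendsto (fun t => G (L t)) atTop (𝓝 l₂)) :
    HasContourIntegral f L (l₂ - l₁) := by
  -- The loop avoids both cuts, since `c ∈ (0, 1)` is its only real point.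
  have hmem : ∀ t, (L t).im ≠ 0 ∨ L t ∈ vStrip 0 1 := fun t => by
    by_cases h : (L t).im = 0
    · have h' : L t ∈ range L ∩ {s : ℂ | s.im = 0} := ⟨mem_range_self t, h⟩
      rw [hL.crossing, mem_singleton_iff] at h'
      right
      rw [h']
      exact ⟨by simpa using hc₀, by simpa using hc₁⟩
    · exact Or.inl h
  have hfc : Continuous (fun t => f (L t)) := continuous_iff_continuousAt.mpr fun t =>
    (hf _ (hmem t)).comp hL.continuous.continuousAt
  have hGc : Continuous (fun t => G (L t)) := continuous_iff_continuousAt.mpr fun t =>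
    (hG _ (hmem t)).continuousAt.comp hL.continuous.continuousAt
  have hint : ∀ a b : ℝ, IntervalIntegrable (fun t => f (L t) * deriv L t) volume a b :=
    fun a b => (hL.integrable_deriv a b).continuousOn_mul hfc.continuousOn
  refine ⟨hint, ?_⟩
  obtain ⟨S, hS, hdiff⟩ := hL.differentiable
  have heq : ∀ a b : ℝ, ∫ t in a..b, f (L t) * deriv L t = G (L b) - G (L a) := fun a b =>
    integral_eq_of_hasDerivAt_off_countable (fun t => G (L t)) _ hS hGc.continuousOn
      (fun t ht => (hG _ (hmem t)).comp t (hdiff t ht.2).hasDerivAt) (hint a b)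
  simp only [heq]
  exact (h₂.comp tendsto_snd).sub (h₁.comp tendsto_fst)

/-! ### Estimates for the sine -/

theorem sin_pi_mul_ne_zero_of_im_ne_zero {s : ℂ} (hs : s.im ≠ 0) :
    Complex.sin (Real.pi * s) ≠ 0 := by
  rw [Complex.sin_ne_zero_iff]
  intro n h
  have := congrArg Complex.im h
  simp [Real.pi_ne_zero, hs] at this

theorem eq_intCast_of_sin_pi_mul_eq_zero {s : ℂ} (hs : Complex.sin (Real.pi * s) = 0) :
    ∃ n : ℤ, s = n := by
  obtain ⟨n, hn⟩ := Complex.sin_eq_zero_iff.mp hs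
  refine ⟨n, mul_left_cancel₀ (Complex.ofReal_ne_zero.mpr Real.pi_ne_zero) ?_⟩
  rw [hn, mul_comm]

theorem sin_pi_mul_ne_zero_of_mem_vStrip {s : ℂ} {k : ℤ} (hs : s ∈ vStrip k (k + 1)) :
    Complex.sin (Real.pi * s) ≠ 0 := by
  intro h
  obtain ⟨n, rfl⟩ := eq_intCast_of_sin_pi_mul_eq_zero h
  obtain ⟨h1, h2⟩ := hs
  rw [Complex.intCast_re] at h1 h2
  norm_cast at h1 h2
  omega

theorem sin_add_nat_mul_pi (w : ℂ) (n : ℕ) :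
    Complex.sin (w + n * Real.pi) = (-1) ^ n * Complex.sin w :=
  Complex.sin_antiperiodic.add_nat_mul_eq n

theorem cos_add_nat_mul_pi (w : ℂ) (n : ℕ) :
    Complex.cos (w + n * Real.pi) = (-1) ^ n * Complex.cos w :=
  Complex.cos_antiperiodic.add_nat_mul_eq n

theorem abs_im_le_norm_sin (w : ℂ) : |w.im| ≤ ‖Complex.sin w‖ := by
  have h1 : |Real.sinh w.im| ≤ ‖Complex.sin w‖ := by
    have h := abs_norm_sub_norm_le (Complex.exp (-w * Complex.I)) (Complex.exp (w * Complex.I))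
    have e1 : (-w * Complex.I).re = w.im := by simp
    have e2 : (w * Complex.I).re = -w.im := by simp
    rw [Complex.norm_exp, Complex.norm_exp, e1, e2] at h
    rw [Real.sinh_eq, Complex.sin, norm_div, norm_mul, Complex.norm_I, mul_one, Complex.norm_two,
      abs_div, abs_two]
    gcongr
  refine le_trans ?_ h1
  rw [Real.abs_sinh]
  exact Real.self_le_sinh_iff.mpr (abs_nonneg _)

theorem one_le_norm_sin_of_re_eq {s : ℂ} {n : ℕ} (hs : s.re = n + 1 / 2) :
    1 ≤ ‖Complex.sin (Real.pi * s)‖ := by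
  have e : (Real.pi : ℂ) * s =
      ((Real.pi * s.im : ℝ) : ℂ) * Complex.I + Real.pi / 2 + n * Real.pi := by
    have : s = (n + 1 / 2 : ℂ) + s.im * Complex.I := by
      apply Complex.ext <;> simp [hs]
    rw [this]
    simp
    ring
  rw [e, sin_add_nat_mul_pi, Complex.sin_add_pi_div_two, Complex.cos_mul_I, norm_mul,
    norm_pow, norm_neg, norm_one, one_pow, one_mul, ← Complex.ofReal_cosh, Complex.norm_real]
  exact (Real.one_le_cosh _).trans (le_abs_self _)

/-! ### The integrand: holomorphy, decay and residues -/

theorem differentiableAt_integrand {α β : ℝ} (γ : ℝ) (z : ℂ) (θ : ℝ) {s : ℂ}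
    (hs : (α : ℂ) * s + β ∈ Complex.slitPlane) (hsin : Complex.sin (Real.pi * s) ≠ 0) :
    DifferentiableAt ℂ (integrand α β γ z θ) s := by
  rw [funext (integrand_eq α β γ z θ)]
  exact ((differentiableAt_integrandReg α β γ z θ hs).const_mul _).div (by fun_prop) hsin

/-- The decay holds away from the poles, which is expressed by a lower bound on `|sin (π s)|`. -/
theorem exists_norm_integrand_le {α β γ : ℝ} (hα : 0 < α) (hβ : 0 < β) (hγ : 0 < γ) (z : ℂ)
    (θ M : ℝ) {m : ℝ} (hm : 0 < m) :
    ∃ K, 0 ≤ K ∧ ∀ s : ℂ, 0 ≤ s.re → |s.im| ≤ M → m ≤ ‖Complex.sin (Real.pi * s)‖ →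
      ‖integrand α β γ z θ s‖ ≤ K * Real.exp (-s.re) := by
  obtain ⟨K, hK0, hK⟩ := exists_norm_integrandReg_le hα hβ hγ z θ M
  refine ⟨Real.pi * K / m, by positivity, fun s h1 h2 h3 => ?_⟩
  rw [integrand_eq, norm_div, norm_mul, norm_neg, Complex.norm_real,
    Real.norm_of_nonneg Real.pi_pos.le, div_mul_eq_mul_div, mul_assoc Real.pi]
  have := hK s h1 h2
  gcongr

/-- At the pole `k + 1` the integrand splits into its principal part and a remainder holomorphic on
`k < Re s < k + 2`. -/
theorem exists_integrand_eq_principal_part_add {α β : ℝ} (hα : 0 < α) (hβ : 0 < β) (γ : ℝ) {z : ℂ}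
    {θ : ℝ} (hz : z ≠ 0) (hθ : (‖z‖ : ℂ) * Complex.exp (Complex.I * (θ : ℂ)) = -z) (k : ℕ) :
    ∃ h : ℂ → ℂ, (∀ s ∈ vStrip k (k + 2), DifferentiableAt ℂ h s) ∧
      ∀ s ∈ vStrip k (k + 2), s ≠ (k + 1 : ℂ) → integrand α β γ z θ s =
        -(z ^ (k + 1) / ((Real.Gamma (α * (k + 1 : ℕ) + β) ^ γ : ℝ) : ℂ)) * (1 / (s - (k + 1)))
          + h s := by
  -- `sin (π s) = (s - a) d(s)` with `d = dslope S a` free of zeros on the strip, so the integrand is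
  -- `u(s) / (s - a)` with `u` holomorphic, and `dslope u a` is what remains of it.
  set a : ℂ := k + 1 with ha
  set S : ℂ → ℂ := fun s => Complex.sin (Real.pi * s) with hS
  have hSd : Differentiable ℂ S := by fun_prop
  have hmem : a ∈ vStrip k (k + 2) := by constructor <;> simp [ha]
  have hnhds : vStrip k (k + 2) ∈ 𝓝 a := (isOpen_vStrip _ _).mem_nhds hmem
  have hpa : (Real.pi : ℂ) * a = 0 + ((k + 1 : ℕ) : ℂ) * Real.pi := by rw [ha]; push_cast; ring
  have hSa : S a = 0 := by
    simp only [hS, hpa, sin_add_nat_mul_pi, Complex.sin_zero, mul_zero]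
  have hS' : deriv S a = (-1) ^ (k + 1) * Real.pi := by
    have h1 : HasDerivAt S (Complex.cos (Real.pi * a) * (Real.pi * 1)) a :=
      ((hasDerivAt_id a).const_mul (Real.pi : ℂ)).csin
    rw [h1.deriv, hpa, cos_add_nat_mul_pi, Complex.cos_zero, mul_one, mul_one]
  have hd : ∀ s, s ≠ a → dslope S a s * (s - a) = S s := fun s hs => by
    rw [dslope_of_ne _ hs, slope_def_field, hSa, sub_zero, div_mul_cancel₀ _ (sub_ne_zero.mpr hs)]
  have hdne : ∀ s ∈ vStrip k (k + 2), dslope S a s ≠ 0 := fun s hs h0 => by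
    by_cases hsa : s = a
    · rw [hsa, dslope_same, hS'] at h0
      simp [Real.pi_ne_zero] at h0
    · have h1 := hd s hsa
      rw [h0, zero_mul] at h1
      obtain ⟨n, hn⟩ := eq_intCast_of_sin_pi_mul_eq_zero h1.symm
      obtain ⟨h2, h3⟩ := hs
      rw [hn, Complex.intCast_re] at h2 h3
      norm_cast at h2 h3
      refine hsa ?_
      have : n = k + 1 := by push_cast at h2 h3; omega
      rw [hn, this, ha]
      push_cast
      rfl
  set u : ℂ → ℂ := fun s => -(Real.pi : ℂ) * integrandReg α β γ z θ s / dslope S a s with hu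
  have hdd : DifferentiableOn ℂ (dslope S a) (vStrip k (k + 2)) :=
    (Complex.differentiableOn_dslope hnhds).mpr hSd.differentiableOn
  have hud : DifferentiableOn ℂ u (vStrip k (k + 2)) := by
    refine DifferentiableOn.div (fun s hs => ?_) hdd hdne
    exact ((differentiableAt_integrandReg α β γ z θ (mem_slitPlane_of_re_nonneg hα hβ
      (k.cast_nonneg.trans hs.1.le))).const_mul _).differentiableWithinAt
  have hua : u a = -(z ^ (k + 1) / ((Real.Gamma (α * (k + 1 : ℕ) + β) ^ γ : ℝ) : ℂ)) := by
    have h1 := integrandReg_natCast hα hβ γ hz hθ (k + 1)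
    rw [Nat.cast_add, Nat.cast_one, ← ha] at h1
    have hpi : (Real.pi : ℂ) ≠ 0 := Complex.ofReal_ne_zero.mpr Real.pi_ne_zero
    have hne : ((-1 : ℂ) ^ (k + 1)) ≠ 0 := by simp
    simp only [hu, dslope_same, hS', h1]
    rw [div_eq_iff (mul_ne_zero hne hpi), neg_pow z]
    push_cast
    ring
  refine ⟨dslope u a, fun s hs => ((Complex.differentiableOn_dslope hnhds).mpr hud).differentiableAt
    ((isOpen_vStrip _ _).mem_nhds hs), fun s hs hsa => ?_⟩
  have hsa' : s - a ≠ 0 := sub_ne_zero.mpr hsa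
  have h1 : Complex.sin (Real.pi * s) = dslope S a s * (s - a) := (hd s hsa).symm
  rw [integrand_eq, h1, ← hua, dslope_of_ne u hsa, slope_def_field]
  have h2 : u s = -(Real.pi : ℂ) * integrandReg α β γ z θ s / dslope S a s := rfl
  rw [← div_div, ← h2]
  ring

theorem hasJump_integrand {α β : ℝ} (hα : 0 < α) (hβ : 0 < β) (γ : ℝ) {z : ℂ} {θ : ℝ}
    (hz : z ≠ 0) (hθ : (‖z‖ : ℂ) * Complex.exp (Complex.I * (θ : ℂ)) = -z) {Gp Gm : ℂ → ℂ}
    (hGp : ∀ s : ℂ, 0 < s.im → HasDerivAt Gp (integrand α β γ z θ s) s)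
    (hGm : ∀ s : ℂ, s.im < 0 → HasDerivAt Gm (integrand α β γ z θ s) s)
    (h0 : HasJump (integrand α β γ z θ) Gp Gm 0 0) (n : ℕ) :
    HasJump (integrand α β γ z θ) Gp Gm n (2 * Real.pi * Complex.I *
      ∑ k ∈ Finset.range n, z ^ (k + 1) / ((Real.Gamma (α * (k + 1 : ℕ) + β) ^ γ : ℝ) : ℂ)) := by
  induction n with
  | zero => simpa using h0
  | succ n ih =>
    obtain ⟨h, hh, hf⟩ := exists_integrand_eq_principal_part_add hα hβ γ hz hθ n
    convert ih.succ hGp hGm hh hf using 1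
    rw [Finset.sum_range_succ]
    ring

/-- A jump is the difference of the two half-plane primitives at the ends of a vertical segment, up
to the integral of `f` over that segment. -/
theorem HasJump.norm_sub_le {f Gp Gm : ℂ → ℂ} {k : ℕ} {C : ℂ} (hJ : HasJump f Gp Gm k C)
    {x y₁ y₂ B : ℝ} (hx₁ : k < x) (hx₂ : x < k + 1) (hy₁ : y₁ < 0) (hy₂ : 0 < y₂)
    (hB : ∀ s : ℂ, s.re = x → s.im ∈ Icc y₁ y₂ → ‖f s‖ ≤ B) :
    ‖Gp ⟨x, y₂⟩ - Gm ⟨x, y₁⟩ - C‖ ≤ B * (y₂ - y₁) := by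
  obtain ⟨Q, hQ⟩ := hJ
  have hmem : ∀ s : ℂ, s.re = x → s ∈ vStrip k (k + 1) := fun s hs => by
    rw [← hs] at hx₁ hx₂
    exact ⟨hx₁, hx₂⟩
  have hc : Convex ℝ ({s : ℂ | s.re = x} ∩ ({s : ℂ | y₁ ≤ s.im} ∩ {s : ℂ | s.im ≤ y₂})) :=
    (convex_hyperplane Complex.reLm.isLinear x).inter
      ((convex_halfSpace_im_ge _).inter (convex_halfSpace_im_le _))
  have h := hc.norm_image_sub_le_of_norm_hasDerivWithin_le (f := Q) (f' := f) (C := B)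
    (x := ⟨x, y₁⟩) (y := ⟨x, y₂⟩)
    (fun s hs => ((hQ s (hmem s hs.1)).1).hasDerivWithinAt) (fun s hs => hB s hs.1 hs.2)
    ⟨rfl, le_refl y₁, (hy₁.trans hy₂).le⟩ ⟨rfl, (hy₁.trans hy₂).le, le_refl y₂⟩
  have e : (⟨x, y₂⟩ - ⟨x, y₁⟩ : ℂ) = ((y₂ - y₁ : ℝ) : ℂ) * Complex.I := by
    apply Complex.ext <;> simp
  rw [e, norm_mul, Complex.norm_I, mul_one, Complex.norm_real,
    Real.norm_of_nonneg (by linarith)] at h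
  rw [(hQ _ (hmem ⟨x, y₂⟩ rfl)).2.1 hy₂, (hQ _ (hmem ⟨x, y₁⟩ rfl)).2.2 hy₁]
  rwa [add_sub_right_comm, add_sub_cancel_right]

end LeRoy

theorem mainTheorem1 (α β γ : ℝ) (hα : 0 < α) (hβ : 0 < β) (hγ : 0 < γ)
    (φ₁ φ₂ c : ℝ) (hφ₁ : φ₁ < 0) (hφ₂ : 0 < φ₂) (hc₀ : 0 < c) (hc₁ : c < 1)
    (L : ℝ → ℂ) (hL : LeRoy.IsRightLoop φ₁ φ₂ c L)
    (z : ℂ) (hz : z ∈ Complex.slitPlane)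
    (θ : ℝ) (hθ : (‖z‖ : ℂ) * Complex.exp (Complex.I * (θ : ℂ)) = -z) :
    Summable (fun k : ℕ => z ^ k / ((Real.Gamma (α * k + β) ^ γ : ℝ) : ℂ)) ∧
    ∃ I : ℂ, LeRoy.HasContourIntegral (LeRoy.integrand α β γ z θ) L I ∧
      LeRoy.leRoy α β γ z =
        1 / (2 * (Real.pi : ℂ) * Complex.I) * I + 1 / ((Real.Gamma β ^ γ : ℝ) : ℂ) := by
  have hz0 : z ≠ 0 := Complex.slitPlane_ne_zero hz
  have hsum := LeRoy.summable_leRoy hα hβ hγ hz0 hθ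
  refine ⟨hsum, ?_⟩
  set f := LeRoy.integrand α β γ z θ with hf
  have hdiff : ∀ s : ℂ, s.im ≠ 0 ∨ s ∈ LeRoy.vStrip 0 1 → DifferentiableAt ℂ f s := by
    rintro s (hs | hs)
    · exact LeRoy.differentiableAt_integrand γ z θ (LeRoy.mem_slitPlane_of_im_ne_zero β hα hs)
        (LeRoy.sin_pi_mul_ne_zero_of_im_ne_zero hs)
    · exact LeRoy.differentiableAt_integrand γ z θ (LeRoy.mem_slitPlane_of_re_nonneg hα hβ hs.1.le)
        (LeRoy.sin_pi_mul_ne_zero_of_mem_vStrip (k := 0) (by simpa using hs))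
  obtain ⟨Gp, Gm, hGp, hGm, hJ0⟩ := LeRoy.exists_matching_primitives
    (fun s hs => hdiff s (Or.inl hs.ne')) (fun s hs => hdiff s (Or.inl hs.ne))
    (fun s hs => hdiff s (Or.inr hs))
  obtain ⟨G, hG, hGpos, hGneg⟩ := hJ0.exists_glued hGp hGm
  have hsin : ∀ {δ : ℝ} {s : ℂ}, δ ≤ |s.im| → Real.pi * δ ≤ ‖Complex.sin (Real.pi * s)‖ :=
    fun {δ s} h => by
      refine le_trans ?_ (LeRoy.abs_im_le_norm_sin _)
      rw [Complex.im_ofReal_mul, abs_mul, abs_of_pos Real.pi_pos]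
      exact mul_le_mul_of_nonneg_left h Real.pi_pos.le
  -- Both half-plane primitives have limits at `+∞` in half-strips around `φ₂` and `φ₁`.
  obtain ⟨l₂, hl₂⟩ : ∃ l : ℂ, ∀ {ι : Type} (F : Filter ι) (u : ι → ℂ),
      Tendsto (fun i => (u i).re) F atTop → (∀ᶠ i in F, (u i).im ∈ Icc (φ₂ / 2) (2 * φ₂)) →
      Tendsto (fun i => G (u i)) F (𝓝 l) := by
    obtain ⟨K, hK0, hK⟩ := LeRoy.exists_norm_integrand_le hα hβ hγ z θ (2 * φ₂)
      (m := Real.pi * (φ₂ / 2)) (by positivity)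
    refine LeRoy.exists_tendsto_of_norm_deriv_le (f := f) (by linarith)
      (fun s _ hs => hG s (Or.inl (by linarith [hs.1] : 0 < s.im).ne')) hK0 (fun s h1 hs => ?_)
    have habs : |s.im| = s.im := abs_of_pos (by linarith [hs.1])
    exact hK s h1 (habs.le.trans hs.2) (hsin (hs.1.trans habs.ge))
  obtain ⟨l₁, hl₁⟩ : ∃ l : ℂ, ∀ {ι : Type} (F : Filter ι) (u : ι → ℂ),
      Tendsto (fun i => (u i).re) F atTop → (∀ᶠ i in F, (u i).im ∈ Icc (2 * φ₁) (φ₁ / 2)) →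
      Tendsto (fun i => G (u i)) F (𝓝 l) := by
    obtain ⟨K, hK0, hK⟩ := LeRoy.exists_norm_integrand_le hα hβ hγ z θ (-(2 * φ₁))
      (m := Real.pi * (-(φ₁ / 2))) (mul_pos Real.pi_pos (by linarith))
    refine LeRoy.exists_tendsto_of_norm_deriv_le (f := f) (by linarith)
      (fun s _ hs => hG s (Or.inl (by linarith [hs.2] : s.im < 0).ne)) hK0 (fun s h1 hs => ?_)
    have habs : |s.im| = -s.im := abs_of_neg (by linarith [hs.2])
    exact hK s h1 (by linarith [hs.1]) (hsin (by linarith [hs.2]))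
  have hmem₂ : Icc (φ₂ / 2) (2 * φ₂) ∈ 𝓝 φ₂ := Icc_mem_nhds (by linarith) (by linarith)
  have hmem₁ : Icc (2 * φ₁) (φ₁ / 2) ∈ 𝓝 φ₁ := Icc_mem_nhds (by linarith) (by linarith)
  refine ⟨l₂ - l₁, hL.hasContourIntegral hc₀ hc₁ (fun s hs => (hdiff s hs).continuousAt) hG
    (hl₁ _ L hL.re_start (hL.im_start.eventually_mem hmem₁))
    (hl₂ _ L hL.re_finish (hL.im_finish.eventually_mem hmem₂)), ?_⟩
  -- The value of the integral is found along the abscissas `n + 1 / 2`.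
  set a : ℕ → ℂ := fun k => z ^ k / ((Real.Gamma (α * k + β) ^ γ : ℝ) : ℂ) with ha
  have hre : Tendsto (fun n : ℕ => (n : ℝ) + 1 / 2) atTop atTop :=
    tendsto_atTop_add_const_right _ _ tendsto_natCast_atTop_atTop
  have hlim : Tendsto (fun n : ℕ => G ⟨n + 1 / 2, φ₂⟩ - G ⟨n + 1 / 2, φ₁⟩) atTop
      (𝓝 (l₂ - l₁)) :=
    (hl₂ atTop (fun n : ℕ => ⟨n + 1 / 2, φ₂⟩) hre (.of_forall fun _ => mem_of_mem_nhds hmem₂)).sub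
      (hl₁ atTop (fun n : ℕ => ⟨n + 1 / 2, φ₁⟩) hre (.of_forall fun _ => mem_of_mem_nhds hmem₁))
  have hzero : Tendsto (fun n : ℕ => G ⟨n + 1 / 2, φ₂⟩ - G ⟨n + 1 / 2, φ₁⟩ -
      2 * Real.pi * Complex.I * ∑ k ∈ Finset.range n, a (k + 1)) atTop (𝓝 0) := by
    obtain ⟨K, -, hK⟩ := LeRoy.exists_norm_integrand_le hα hβ hγ z θ (max |φ₁| |φ₂|) one_pos
    have hexp : Tendsto (fun n : ℕ => K * Real.exp (-((n : ℝ) + 1 / 2)) * (φ₂ - φ₁)) atTop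
        (𝓝 0) := by
      simpa using ((Real.tendsto_exp_neg_atTop_nhds_zero.comp hre).const_mul K).mul_const (φ₂ - φ₁)
    refine squeeze_zero_norm (fun n => ?_) hexp
    rw [hGpos _ hφ₂, hGneg _ hφ₁]
    refine (LeRoy.hasJump_integrand hα hβ γ hz0 hθ hGp hGm hJ0 n).norm_sub_le (by linarith)
      (by linarith) hφ₁ hφ₂ fun s hs hs' => ?_
    rw [← hs]
    exact hK s (by rw [hs]; positivity) (abs_le_max_abs_abs hs'.1 hs'.2)
      (LeRoy.one_le_norm_sin_of_re_eq hs)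
  have hseries : Tendsto (fun n : ℕ => 2 * Real.pi * Complex.I * ∑ k ∈ Finset.range n, a (k + 1))
      atTop (𝓝 (2 * Real.pi * Complex.I * ∑' k, a (k + 1))) :=
    (((summable_nat_add_iff 1).mpr hsum).hasSum.tendsto_sum_nat).const_mul _
  have hval : l₂ - l₁ = 2 * Real.pi * Complex.I * ∑' k, a (k + 1) := by
    have h := hzero.add hseries
    simp only [sub_add_cancel, zero_add] at h
    exact tendsto_nhds_unique hlim h
  have hsplit : LeRoy.leRoy α β γ z = a 0 + ∑' k, a (k + 1) := hsum.tsum_eq_zero_add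
  rw [hsplit, hval, one_div_mul_eq_div, mul_div_cancel_left₀ _ Complex.two_pi_I_ne_zero, add_comm]
  simp [ha]
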